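/- A \emph{monotone mountain} is a simple polygon $P$ (a closed region, no three consecutive vertices collinear) that meets every vertical line in a connected set and whose upper chain between its leftmost and its rightmost point is a single horizontal segment. A vertex is \emph{reflex} if the interior angle there exceeds $\pi$. A \emph{half guard} is a point $g\in P$ together with a direction, left or right. A left-looking (right-looking) half guard $g$ sees a point $p\in P$ iff the segment $\overline{gp}$ is contained in $P$ and the $x$-coordinate of $p$ is not larger (not smaller) than that of $g$. We say that $k$ half guards \emph{suffice} for $P$ if some set of at most $k$ half guards, left- and right-looking ones mixed arbitrarily, sees every point of $P$, and that $k$ are \emph{necessary} for $P$ if every finite set of half guards that sees every point of $P$ has at least $k$ elements. \textbf{Theorem.} Consider monotone mountains with exactly $n$ vertices, exactly $r$ of them reflex. 1. Let $r<n/2$. Then $r+1$ half guards suffice for every such mountain. They are sometimes necessary: for all $n,r$ with $n\ge 2r+3$ there is such a mountain for which $r+1$ half guards are necessary. 2. Let $n/2\le r\le 3n/4$. Then $\lfloor n/2\rfloor$ half guards suffice for every such mountain. They are sometimes necessary: for every odd $n$ and every $r$ with $n/2\le r\le (3n-7)/4$ there is such a mountain for which $\lfloor n/2\rfloor$ half guards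 are necessary. For every even $n$ and every $r$ with $n/2\le r\le (3n-7)/4$ there is such a mountain for which $n/2-1$ half guards are necessary. 3. Let $r>3n/4$ and $r\le n-3$. Then $2(n-r-2)\le n/2$, the number $2(n-r-2)$ of half guards suffices for every such mountain, and there is such a mountain for which $2(n-r-2)$ half guards are necessary. -/

import Mathlib

namespace Polygon

/-- Twice the signed area of the triangle `a b c`: positive for a left turn at `b`, negative for a
right turn, zero iff the three points are collinear. -/
def turn (a b c : ℝ × ℝ) : ℝ :=
  (b.1 - a.1) * (c.2 - a.2) - (b.2 - a.2) * (c.1 - a.1)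

/-- The polygon `P` (with `n` vertices, no three consecutive ones collinear) is a monotone mountain
whose upper chain is one horizontal segment. The vertices are listed counterclockwise: vertex `0` is
the left end of the horizontal segment, vertex `⊤` (the last one) is its right end, and in between
one walks along the lower chain, which is (weakly) `x`-monotone, so vertical edges are allowed, and
runs strictly below the horizontal segment. Such a closed polygonal curve is automatically simple:
by nondegeneracy at most two vertices, and these consecutive, share an `x`-coordinate. -/
structure IsMonotoneMountain {n : ℕ} [NeZero n] (P : Polygon (ℝ × ℝ) n) : Prop where
  nondegenerate : P.HasNondegenerateVertices ℝ
  horizontal : (P ⊤).2 = (P 0).2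
  monotone : Monotone fun i : Fin n => (P i).1
  below : ∀ i : Fin n, i ≠ 0 → i ≠ ⊤ → (P i).2 < (P 0).2

/-- The lower chain: the union of all edges except the one that joins the last vertex to the
first. -/
def lowerChain {n : ℕ} [NeZero n] (P : Polygon (ℝ × ℝ) n) : Set (ℝ × ℝ) :=
  ⋃ (i : Fin n) (_ : i ≠ ⊤), P.edgeSet ℝ i

/-- The closed region bounded by a monotone mountain: the points that lie neither above the
horizontal segment nor below the lower chain. -/
def region {n : ℕ} [NeZero n] (P : Polygon (ℝ × ℝ) n) : Set (ℝ × ℝ) :=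
  {p | p.2 ≤ (P 0).2 ∧ ∃ q ∈ P.lowerChain, q.1 = p.1 ∧ q.2 ≤ p.2}

/-- The number of reflex vertices (interior angle larger than `π`). As the vertices are listed
counterclockwise, these are the vertices at which the boundary turns right. Indices are cyclic. -/
noncomputable def reflexCount {n : ℕ} [NeZero n] (P : Polygon (ℝ × ℝ) n) : ℕ :=
  {i : Fin n | turn (P (i - 1)) (P i) (P (i + 1)) < 0}.ncard

end Polygon

/-- The direction in which a half guard looks. -/
inductive LookDir where
  | left
  | right

/-- A half guard: a position together with the direction in which it looks. -/
structure HalfGuard where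
  pos : ℝ × ℝ
  dir : LookDir

namespace HalfGuard

/-- The point `p` lies on the side (closed half-plane) that the half guard looks at. -/
def Faces (g : HalfGuard) (p : ℝ × ℝ) : Prop :=
  match g.dir with
  | LookDir.left => p.1 ≤ g.pos.1
  | LookDir.right => g.pos.1 ≤ p.1

/-- The half guard `g` sees `p` inside the region `R`. -/
def Sees (R : Set (ℝ × ℝ)) (g : HalfGuard) (p : ℝ × ℝ) : Prop :=
  segment ℝ g.pos p ⊆ R ∧ g.Faces p

end HalfGuard

namespace Polygon

/-- `G` is a set of half guards placed in the polygon `P` that together see all of it. -/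
def IsHalfGuardCover {n : ℕ} [NeZero n] (P : Polygon (ℝ × ℝ) n) (G : Finset HalfGuard) : Prop :=
  (∀ g ∈ G, g.pos ∈ P.region) ∧ ∀ p ∈ P.region, ∃ g ∈ G, g.Sees P.region p

/-- `k` half guards suffice for `P`. -/
def HalfGuardsSuffice {n : ℕ} [NeZero n] (P : Polygon (ℝ × ℝ) n) (k : ℕ) : Prop :=
  ∃ G : Finset HalfGuard, P.IsHalfGuardCover G ∧ G.card ≤ k

/-- `k` half guards are necessary for `P`. -/
def HalfGuardsNecessary {n : ℕ} [NeZero n] (P : Polygon (ℝ × ℝ) n) (k : ℕ) : Prop :=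
  ∀ G : Finset HalfGuard, P.IsHalfGuardCover G → k ≤ G.card

end Polygon

/-!
The lower chain of a mountain with `n` vertices has `N = n - 1` edges. It decomposes into *valleys*:
a descending run of edges followed by an ascending run.

**Upper bounds.** Guards are placed on the horizontal edge, from where a guard that sees a point of
the chain sees everything above that point as well, so it is enough to see the lower chain. A
left-looking guard above the bottom of a valley sees the whole descending run, and a right-looking
one the ascending run, so two guards always see a valley. One guard is enough if the valley has no
reflex vertex in its interior, since the part of the region above it is then convex
(`seesEdge_of_convex`), or if one of the two runs is a single edge: above the far end of that edge,
a guard looks into the valley from above the edge (`seesEdge_left`, `seesEdge_right`). Hence the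
number of guards spent on a valley is at most half the number of its edges (two guards are spent
only if there are at least four edges), at most one more than the number of its interior reflex
vertices, and at most `2`. As consecutive valleys are separated by a peak, which is a reflex vertex,
and the bottom of a valley is a convex vertex,
summation over the
valleys bounds the number of guards by `N / 2`, by `r + 1` and by `2 (n - r - 2)` simultaneously
(`exists_guards_from`, `exists_cover`).

**Lower bounds.** The vertices of the examples lie at consecutive integer abscissas, so the sign of
a turn is the sign of a second difference of heights. A *narrow* valley has two edges and a deep
bottom; a *wide* valley has four edges and a reflex vertex on either side. The peaks reach
almost up to the horizontal edge, so that no half guard looks deep into two valleys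
(`not_sees_two_valleys`). In a wide valley no half guard sees both outer edges and the bottom
(`not_sees_wide_valley`), so two guards are necessary there. An additional arc at the left corner,
concave or convex, adjusts the number of reflex or of convex vertices without changing the number of
guards.
-/

namespace MonotoneMountain

open Polygon

/-! ### The lower chain of a monotone mountain -/

/-- The closed region below height `h` and above the polygonal chain `v 0, …, v N`. -/
def chainRegion (v : ℕ → ℝ × ℝ) (N : ℕ) (h : ℝ) : Set (ℝ × ℝ) :=
  {p | p.2 ≤ h ∧ ∃ j < N, ∃ q ∈ segment ℝ (v j) (v (j + 1)), q.1 = p.1 ∧ q.2 ≤ p.2}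

/-- The interior vertices strictly between `k` and `l` at which the chain `v` turns right. -/
noncomputable def reflexIn (v : ℕ → ℝ × ℝ) (k l : ℕ) : Finset ℕ :=
  {j ∈ Finset.Ioo k l | turn (v (j - 1)) (v j) (v (j + 1)) < 0}

/-- The interior vertices strictly between `k` and `l` at which the chain `v` turns left. -/
noncomputable def convexIn (v : ℕ → ℝ × ℝ) (k l : ℕ) : Finset ℕ :=
  {j ∈ Finset.Ioo k l | 0 < turn (v (j - 1)) (v j) (v (j + 1))}

theorem affineIndependent_iff_turn_ne_zero (a b c : ℝ × ℝ) :
    AffineIndependent ℝ ![a, b, c] ↔ turn a b c ≠ 0 := by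
  rw [affineIndependent_iff_not_collinear_set, not_iff_not,
    collinear_iff_of_mem (p₀ := a) (by simp)]
  constructor
  · rintro ⟨w, hw⟩
    obtain ⟨s, rfl⟩ := hw b (by simp)
    obtain ⟨t, rfl⟩ := hw c (by simp)
    simp [turn]
    ring
  · intro ht
    by_cases hab : a = b
    · refine ⟨c - a, ?_⟩
      simp only [Set.mem_insert_iff, Set.mem_singleton_iff, forall_eq_or_imp, forall_eq]
      exact ⟨⟨0, by simp⟩, ⟨0, by simp [hab]⟩, ⟨1, by simp⟩⟩
    · refine ⟨b - a, ?_⟩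
      simp only [Set.mem_insert_iff, Set.mem_singleton_iff, forall_eq_or_imp, forall_eq]
      refine ⟨⟨0, by simp⟩, ⟨1, by simp⟩, ?_⟩
      unfold turn at ht
      by_cases h1 : b.1 - a.1 = 0
      · have h2 : b.2 - a.2 ≠ 0 := fun h2 =>
          hab (Prod.ext (by linarith) (by linarith))
        refine ⟨(c.2 - a.2) / (b.2 - a.2), ?_⟩
        have h3 : c.1 - a.1 = 0 := by
          rw [h1] at ht
          have : (b.2 - a.2) * (c.1 - a.1) = 0 := by linarith
          exact (mul_eq_zero.1 this).resolve_left h2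
        ext
        · simp [h1]; linarith
        · simp; field_simp; ring
      · refine ⟨(c.1 - a.1) / (b.1 - a.1), ?_⟩
        ext
        · simp; field_simp; ring
        · simp; field_simp; linarith

section Bridge

variable {N : ℕ} [NeZero (N + 1)] {P : Polygon (ℝ × ℝ) (N + 1)} {v : ℕ → ℝ × ℝ}

theorem val_succ {i : Fin (N + 1)} (hi : i.val < N) : (i + 1).val = i.val + 1 :=
  Fin.val_add_one_of_lt (Fin.lt_def.2 (by simpa using hi))

theorem add_two_eq (i : Fin (N + 1)) : i + 2 = i + 1 + 1 := by
  have : (2 : Fin (N + 1)) = 1 + 1 := by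
    ext
    rw [Fin.val_add]
    change 2 % (N + 1) = (1 % (N + 1) + 1 % (N + 1)) % (N + 1)
    rw [← Nat.add_mod]
  rw [this, add_assoc]

theorem region_eq_chainRegion (hv : ∀ i : Fin (N + 1), P i = v i) :
    P.region = chainRegion v N (v 0).2 := by
  have key : ∀ i : Fin (N + 1), i.val < N →
      P.edgeSet ℝ i = segment ℝ (v i.val) (v (i.val + 1)) := by
    intro i hi
    rw [edgeSet, affineSegment_eq_segment, finRotate_apply, hv, hv, val_succ hi]
  have htop : ∀ i : Fin (N + 1), i ≠ ⊤ ↔ i.val < N := by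
    intro i
    rw [Ne, Fin.ext_iff, Fin.val_top]
    omega
  ext p
  simp only [region, chainRegion, lowerChain, Set.mem_ofPred_eq, Set.mem_iUnion, hv 0,
    Fin.val_zero]
  refine and_congr Iff.rfl ⟨?_, ?_⟩
  · rintro ⟨q, ⟨i, hi, hq⟩, h⟩
    rw [htop] at hi
    exact ⟨i, hi, q, key i hi ▸ hq, h⟩
  · rintro ⟨j, hj, q, hq, h⟩
    refine ⟨q, ⟨⟨j, by omega⟩, (htop _).2 hj, ?_⟩, h⟩
    rw [key _ hj]
    exact hq

theorem turn_interior (hv : ∀ i : Fin (N + 1), P i = v i) (i : Fin (N + 1)) (h0 : 0 < i.val)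
    (h1 : i.val < N) :
    turn (P (i - 1)) (P i) (P (i + 1)) = turn (v (i.val - 1)) (v i) (v (i.val + 1)) := by
  have : (i - 1).val = i.val - 1 := by
    have hi : (⟨i.val - 1, by omega⟩ : Fin (N + 1)) + 1 = i := by
      ext
      rw [val_succ (by simp; omega)]
      simp; omega
    conv_lhs => rw [← hi]
    simp
  rw [hv, hv, hv, this, val_succ h1]

theorem reflexCount_eq (hv : ∀ i : Fin (N + 1), P i = v i) (hN : 2 ≤ N)
    (hx : (v 0).1 ≤ (v N).1) (htop : (v N).2 = (v 0).2) (h1 : (v 1).2 ≤ (v 0).2)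
    (hlast : (v (N - 1)).2 ≤ (v 0).2) :
    P.reflexCount = (reflexIn v 0 N).card := by
  have hset : {i : Fin (N + 1) | turn (P (i - 1)) (P i) (P (i + 1)) < 0} =
      Fin.val ⁻¹' (reflexIn v 0 N : Set ℕ) := by
    ext i
    simp only [Set.mem_ofPred_eq, Set.mem_preimage, reflexIn, Finset.coe_filter, Finset.mem_Ioo]
    rcases Nat.eq_zero_or_pos i.val with h0 | h0
    · have hi : i = 0 := Fin.ext h0
      have e1 : P (i - 1) = v N := by
        rw [hv, hi]; congr 1; simp
      have e2 : P (i + 1) = v 1 := by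
        rw [hv, val_succ (by omega), h0]
      have : ¬ turn (P (i - 1)) (P i) (P (i + 1)) < 0 := by
        rw [e1, e2, hv, h0, turn, htop]
        nlinarith
      constructor
      · intro h; exact absurd h this
      · rintro ⟨⟨h, -⟩, -⟩; omega
    rcases Nat.lt_or_ge i.val N with h2 | h2
    · rw [turn_interior hv i h0 h2]
      simp [h0, h2]
    · have hi : i = Fin.last N := Fin.ext (by simp; omega)
      have e2 : P (i + 1) = v 0 := by
        rw [hv, hi]; simp
      have e1 : P (i - 1) = v (N - 1) := by
        have : (⟨N - 1, by omega⟩ : Fin (N + 1)) + 1 = i := by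
          ext
          rw [val_succ (by simp; omega)]
          simp [hi]; omega
        rw [hv, ← this]; simp
      have e3 : P i = v N := by rw [hv, hi]; simp
      have : ¬ turn (P (i - 1)) (P i) (P (i + 1)) < 0 := by
        rw [e1, e2, e3, turn, htop]
        nlinarith
      constructor
      · intro h; exact absurd h this
      · rintro ⟨⟨-, h⟩, -⟩; omega
  rw [reflexCount, hset, ← Set.ncard_coe_finset,
    ← Set.ncard_image_of_injective _ Fin.val_injective, Set.image_preimage_eq_of_subset]
  intro j hj
  simp only [reflexIn, Finset.coe_filter, Finset.mem_Ioo, Set.mem_ofPred_eq] at hj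
  exact ⟨⟨j, by omega⟩, rfl⟩

/-- The data of a monotone mountain, in terms of its lower chain `v 0, …, v N` indexed by natural
numbers. The values of `v` beyond `N` are irrelevant. -/
structure IsMountainChain (v : ℕ → ℝ × ℝ) (N : ℕ) : Prop where
  two_le : 2 ≤ N
  horizontal : (v N).2 = (v 0).2
  monotone : ∀ j < N, (v j).1 ≤ (v (j + 1)).1
  below : ∀ j, 0 < j → j < N → (v j).2 < (v 0).2
  turn_ne : ∀ j, 0 < j → j < N → turn (v (j - 1)) (v j) (v (j + 1)) ≠ 0

theorem IsMountainChain.le_of_le {v : ℕ → ℝ × ℝ} {N : ℕ} (hc : IsMountainChain v N) {i j : ℕ}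
    (hij : i ≤ j) (hj : j ≤ N) : (v i).1 ≤ (v j).1 := by
  induction j, hij using Nat.le_induction with
  | base => exact le_rfl
  | succ m _ ih => exact (ih (by omega)).trans (hc.monotone m (by omega))

theorem IsMountainChain.le_height {v : ℕ → ℝ × ℝ} {N : ℕ} (hc : IsMountainChain v N) {j : ℕ}
    (hj : j ≤ N) : (v j).2 ≤ (v 0).2 := by
  rcases Nat.eq_zero_or_pos j with rfl | h
  · exact le_rfl
  rcases hj.eq_or_lt with rfl | h'
  · exact hc.horizontal.le
  · exact (hc.below j h h').le

theorem IsMountainChain.reflexCount_eq (hc : IsMountainChain v N)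
    (hv : ∀ i : Fin (N + 1), P i = v i) : P.reflexCount = (reflexIn v 0 N).card :=
  have := hc.two_le
  MonotoneMountain.reflexCount_eq hv this (hc.le_of_le N.zero_le le_rfl) hc.horizontal
    (hc.le_height (by omega)) (hc.le_height (by omega))

theorem isMountainChain_of_isMonotoneMountain (hv : ∀ i : Fin (N + 1), P i = v i)
    (hP : P.IsMonotoneMountain) : IsMountainChain v N := by
  have htop : P ⊤ = v N := by rw [hv]; simp
  have h0 : P 0 = v 0 := by rw [hv]; simp
  have hval : ∀ j (hj : j < N + 1), P ⟨j, hj⟩ = v j := fun j hj => hv _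
  refine ⟨?_, ?_, ?_, ?_, ?_⟩
  · have := hP.nondegenerate.three_le
    omega
  · rw [← htop, ← h0]
    exact hP.horizontal
  · intro j hj
    rw [← hval j (by omega), ← hval (j + 1) (by omega)]
    exact hP.monotone (Fin.mk_le_mk.2 (by omega))
  · intro j hj hjN
    rw [← hval j (by omega), ← h0]
    refine hP.below _ ?_ ?_
    · rw [Ne, Fin.ext_iff]; simp; omega
    · rw [Ne, Fin.ext_iff, Fin.val_top]; simp; omega
  · intro j hj hjN
    have h := hP.nondegenerate ⟨j - 1, by omega⟩
    have e1 : (⟨j - 1, by omega⟩ : Fin (N + 1)) + 1 = ⟨j, by omega⟩ := by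
      ext; rw [val_succ (by simp; omega)]; simp; omega
    have e2 : (⟨j - 1, by omega⟩ : Fin (N + 1)) + 2 = ⟨j + 1, by omega⟩ := by
      rw [add_two_eq, e1]
      ext; rw [val_succ (by simpa using hjN)]
    rw [e1, e2, affineIndependent_iff_turn_ne_zero, hval, hval, hval] at h
    exact h

/-- The two corners of the horizontal edge are never degenerate, provided that the chain does not
collapse to a vertical line. -/
theorem IsMountainChain.isMonotoneMountain (hc : IsMountainChain v N)
    (hx : (v 0).1 < (v N).1) (hv : ∀ i : Fin (N + 1), P i = v i) : P.IsMonotoneMountain := by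
  have hN := hc.two_le
  have htop : P ⊤ = v N := by rw [hv]; simp
  have h0 : P 0 = v 0 := by rw [hv]; simp
  refine ⟨?_, ?_, ?_, ?_⟩
  · intro i
    rw [affineIndependent_iff_turn_ne_zero]
    rcases Nat.lt_or_ge i.val N with h | h
    · have e1 := val_succ h
      rw [add_two_eq]
      rcases Nat.lt_or_ge (i.val + 1) N with h' | h'
      · have e2 := val_succ (i := i + 1) (by omega)
        rw [hv, hv, hv, e2, e1]
        have := hc.turn_ne (i.val + 1) (by omega) h'
        simpa using this
      · have e2 : i + 1 = Fin.last N := Fin.ext (by simp; omega)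
        have e3 : i.val = N - 1 := by omega
        rw [hv, hv, e2, hv, e3]
        have := hc.below (N - 1) (by omega) (by omega)
        simp only [Fin.val_last, Fin.last_add_one, Fin.val_zero, turn]
        rw [hc.horizontal]
        have : (v (N - 1)).2 ≠ (v 0).2 := this.ne
        have hm : ((v 0).2 - (v (N - 1)).2) * ((v N).1 - (v 0).1) ≠ 0 :=
          mul_ne_zero (sub_ne_zero.2 this.symm) (sub_ne_zero.2 hx.ne')
        intro h; apply hm; linarith
    · have e1 : i = Fin.last N := Fin.ext (by simp; omega)
      rw [add_two_eq, e1, Fin.last_add_one, zero_add, hv, hv, hv]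
      have e2 : (1 : Fin (N + 1)).val = 1 := by
        rw [← zero_add (1 : Fin (N + 1)), val_succ (by simp; omega)]; simp
      have := hc.below 1 (by omega) (by omega)
      rw [e2, Fin.val_last, Fin.val_zero, turn, hc.horizontal]
      have hm : ((v 0).2 - (v 1).2) * ((v N).1 - (v 0).1) ≠ 0 :=
        mul_ne_zero (sub_ne_zero.2 this.ne') (sub_ne_zero.2 hx.ne')
      intro h; apply hm; linarith
  · rw [htop, h0]; exact hc.horizontal
  · intro i j hij
    simp only [hv]
    exact hc.le_of_le hij (by omega)
  · intro i hi ht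
    rw [hv, h0]
    refine hc.below _ ?_ ?_
    · exact Nat.pos_of_ne_zero fun h => hi (Fin.ext h)
    · rw [Ne, Fin.ext_iff, Fin.val_top] at ht
      omega

end Bridge

/-! ### Visibility from the horizontal edge -/

theorem exists_step_mem {x : ℕ → ℝ} {a b : ℕ} {t : ℝ} (hab : a < b) (ha : x a ≤ t)
    (hb : t ≤ x b) : ∃ m, a ≤ m ∧ m < b ∧ x m ≤ t ∧ t ≤ x (m + 1) := by
  induction b, hab using Nat.le_induction with
  | base => exact ⟨a, le_rfl, Nat.lt_succ_self a, ha, hb⟩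
  | succ b h ih =>
    rcases le_total t (x b) with h' | h'
    · obtain ⟨m, h1, h2, h3⟩ := ih h'
      exact ⟨m, h1, by omega, h3⟩
    · exact ⟨b, Nat.le_of_succ_le h, b.lt_succ_self, h', hb⟩

/-- Every abscissa between those of `a` and `b` is attained on the segment from `a` to `b`, at a
point that lies in any half-plane containing both end points. -/
theorem exists_mem_segment_fst_eq {a b : ℝ × ℝ} {t : ℝ} (ha : a.1 ≤ t) (hb : t ≤ b.1) :
    ∃ z ∈ segment ℝ a b, z.1 = t ∧ ∀ α β γ : ℝ, α * a.2 + β * a.1 ≤ γ →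
      α * b.2 + β * b.1 ≤ γ → α * z.2 + β * z.1 ≤ γ := by
  have ht : t ∈ segment ℝ a.1 b.1 := by
    rw [segment_eq_Icc (ha.trans hb)]
    exact ⟨ha, hb⟩
  obtain ⟨x, y, hx, hy, hxy, rfl⟩ := ht
  refine ⟨x • a + y • b, ⟨x, y, hx, hy, hxy, rfl⟩, by simp, fun α β γ h1 h2 => ?_⟩
  have : γ = x * γ + y * γ := by rw [← add_mul, hxy, one_mul]
  simp only [Prod.snd_add, Prod.smul_snd, smul_eq_mul, Prod.fst_add, Prod.smul_fst]
  nlinarith [mul_le_mul_of_nonneg_left h1 hx, mul_le_mul_of_nonneg_left h2 hy]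

theorem fst_mem_Icc_of_mem_segment {a b q : ℝ × ℝ} (hq : q ∈ segment ℝ a b) (h : a.1 ≤ b.1) :
    a.1 ≤ q.1 ∧ q.1 ≤ b.1 := by
  obtain ⟨x, y, hx, hy, hxy, rfl⟩ := hq
  obtain rfl : x = 1 - y := by linarith
  simp only [Prod.fst_add, Prod.smul_fst, smul_eq_mul]
  constructor <;> nlinarith

theorem snd_mem_Icc_of_mem_segment {a b q : ℝ × ℝ} (hq : q ∈ segment ℝ a b) (h : a.2 ≤ b.2) :
    a.2 ≤ q.2 ∧ q.2 ≤ b.2 := by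
  obtain ⟨x, y, hx, hy, hxy, rfl⟩ := hq
  obtain rfl : x = 1 - y := by linarith
  simp only [Prod.snd_add, Prod.smul_snd, smul_eq_mul]
  constructor <;> nlinarith

section Visibility

variable {v : ℕ → ℝ × ℝ} {N : ℕ} {h : ℝ}

/-- A point of the region sees everything in the region that lies above some point it sees. -/
theorem segment_subset_chainRegion_of_le {g p q : ℝ × ℝ} (hg : g.2 ≤ h) (hp : p.2 ≤ h)
    (hqp : q.1 = p.1) (hle : q.2 ≤ p.2) (hq : segment ℝ g q ⊆ chainRegion v N h) :
    segment ℝ g p ⊆ chainRegion v N h := by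
  rintro _ ⟨x, y, hx, hy, hxy, rfl⟩
  obtain ⟨-, j, hj, z, hz, hz1, hz2⟩ := hq ⟨x, y, hx, hy, hxy, rfl⟩
  simp only [Prod.snd_add, Prod.smul_snd, smul_eq_mul, Prod.fst_add, Prod.smul_fst] at hz1 hz2
  refine ⟨?_, j, hj, z, hz, ?_, ?_⟩
  · obtain rfl : x = 1 - y := by linarith
    simp only [Prod.snd_add, Prod.smul_snd, smul_eq_mul]
    nlinarith
  · simp [hz1, hqp]
  · simp only [Prod.snd_add, Prod.smul_snd, smul_eq_mul]
    nlinarith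

/-- A point `q` on the `j`-th edge is visible from the point at height `h` above the vertex `v l`
to its right if no vertex in between rises above the line of sight. -/
theorem segment_subset_chainRegion_left {j l : ℕ} {q : ℝ × ℝ}
    (hq : q ∈ segment ℝ (v j) (v (j + 1))) (hjl : j < l) (hl : l ≤ N)
    (hx : q.1 ≤ (v l).1) (hqh : q.2 ≤ h)
    (hbelow : ∀ m, j < m → m ≤ l →
      ((v l).1 - q.1) * ((v m).2 - q.2) ≤ (h - q.2) * ((v m).1 - q.1)) :
    segment ℝ ((v l).1, h) q ⊆ chainRegion v N h := by
  rintro _ ⟨a, b, ha, hb, hab, rfl⟩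
  obtain rfl : b = 1 - a := by linarith
  set s : ℝ × ℝ := a • ((v l).1, h) + (1 - a) • q with hs
  have hs1 : s.1 = q.1 + a * ((v l).1 - q.1) := by simp [hs]; ring
  have hs2 : s.2 = q.2 + a * (h - q.2) := by simp [hs]; ring
  refine ⟨by rw [hs2]; nlinarith, ?_⟩
  rcases hx.eq_or_lt with heq | hlt
  · exact ⟨j, by omega, q, hq, by rw [hs1, ← heq]; simp, by rw [hs2]; nlinarith⟩
  -- the piece of the chain from `q` to `v l` stays below the line of sight
  have fin : ∀ z₁ z₂ : ℝ × ℝ, z₁.1 ≤ s.1 → s.1 ≤ z₂.1 →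
      ((v l).1 - q.1) * (z₁.2 - q.2) ≤ (h - q.2) * (z₁.1 - q.1) →
      ((v l).1 - q.1) * (z₂.2 - q.2) ≤ (h - q.2) * (z₂.1 - q.1) →
      ∃ z ∈ segment ℝ z₁ z₂, z.1 = s.1 ∧ z.2 ≤ s.2 := by
    intro z₁ z₂ h1 h2 hz1 hz2
    obtain ⟨z, hz, hzs, hlin⟩ := exists_mem_segment_fst_eq h1 h2
    refine ⟨z, hz, hzs, ?_⟩
    have := hlin ((v l).1 - q.1) (-(h - q.2)) (((v l).1 - q.1) * q.2 - (h - q.2) * q.1)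
      (by linarith) (by linarith)
    rw [hzs, hs1] at this
    rw [hs2]
    have hpos : 0 < (v l).1 - q.1 := by linarith
    refine le_of_mul_le_mul_left ?_ hpos
    linarith
  have hqs : q.1 ≤ s.1 := by rw [hs1]; nlinarith
  rcases le_total s.1 (v (j + 1)).1 with h1 | h1
  · obtain ⟨z, hz, hz'⟩ := fin q (v (j + 1)) hqs h1 (by simp)
      (hbelow _ (by omega) (by omega))
    exact ⟨j, by omega, z,
      (convex_segment _ _).segment_subset hq (right_mem_segment _ _ _) hz, hz'⟩
  · have hsl : s.1 ≤ (v l).1 := by rw [hs1]; nlinarith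
    rcases (Nat.succ_le_of_lt hjl).eq_or_lt with rfl | hjl'
    · obtain ⟨z, hz, hz'⟩ := fin q (v (j + 1)) hqs hsl (by simp)
        (hbelow _ (by omega) (by omega))
      exact ⟨j, by omega, z,
        (convex_segment _ _).segment_subset hq (right_mem_segment _ _ _) hz, hz'⟩
    · obtain ⟨m, hm1, hm2, hm3, hm4⟩ := exists_step_mem (x := fun i => (v i).1) hjl' h1 hsl
      obtain ⟨z, hz, hz'⟩ := fin _ _ hm3 hm4 (hbelow _ (by omega) (by omega))
        (hbelow _ (by omega) (by omega))
      exact ⟨m, by omega, z, hz, hz'⟩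

/-- The mirror image of `segment_subset_chainRegion_left`. -/
theorem segment_subset_chainRegion_right {j k : ℕ} {q : ℝ × ℝ}
    (hq : q ∈ segment ℝ (v j) (v (j + 1))) (hkj : k ≤ j) (hj : j < N)
    (hx : (v k).1 ≤ q.1) (hqh : q.2 ≤ h)
    (hbelow : ∀ m, k ≤ m → m ≤ j →
      (q.1 - (v k).1) * ((v m).2 - q.2) ≤ (h - q.2) * (q.1 - (v m).1)) :
    segment ℝ ((v k).1, h) q ⊆ chainRegion v N h := by
  rintro _ ⟨a, b, ha, hb, hab, rfl⟩
  obtain rfl : b = 1 - a := by linarith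
  set s : ℝ × ℝ := a • ((v k).1, h) + (1 - a) • q with hs
  have hs1 : s.1 = q.1 - a * (q.1 - (v k).1) := by simp [hs]; ring
  have hs2 : s.2 = q.2 + a * (h - q.2) := by simp [hs]; ring
  refine ⟨by rw [hs2]; nlinarith, ?_⟩
  rcases hx.eq_or_lt with heq | hlt
  · exact ⟨j, by omega, q, hq, by rw [hs1, heq]; simp, by rw [hs2]; nlinarith⟩
  have fin : ∀ z₁ z₂ : ℝ × ℝ, z₁.1 ≤ s.1 → s.1 ≤ z₂.1 →
      (q.1 - (v k).1) * (z₁.2 - q.2) ≤ (h - q.2) * (q.1 - z₁.1) →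
      (q.1 - (v k).1) * (z₂.2 - q.2) ≤ (h - q.2) * (q.1 - z₂.1) →
      ∃ z ∈ segment ℝ z₁ z₂, z.1 = s.1 ∧ z.2 ≤ s.2 := by
    intro z₁ z₂ h1 h2 hz1 hz2
    obtain ⟨z, hz, hzs, hlin⟩ := exists_mem_segment_fst_eq h1 h2
    refine ⟨z, hz, hzs, ?_⟩
    have := hlin (q.1 - (v k).1) (h - q.2) ((q.1 - (v k).1) * q.2 + (h - q.2) * q.1)
      (by linarith) (by linarith)
    rw [hzs, hs1] at this
    rw [hs2]
    have hpos : 0 < q.1 - (v k).1 := by linarith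
    refine le_of_mul_le_mul_left ?_ hpos
    linarith
  have hqs : s.1 ≤ q.1 := by rw [hs1]; nlinarith
  have hsk : (v k).1 ≤ s.1 := by rw [hs1]; nlinarith
  rcases le_total (v j).1 s.1 with h1 | h1
  · obtain ⟨z, hz, hz'⟩ := fin (v j) q h1 hqs (hbelow _ (by omega) (by omega)) (by simp)
    exact ⟨j, by omega, z,
      (convex_segment _ _).segment_subset (left_mem_segment _ _ _) hq hz, hz'⟩
  · rcases hkj.eq_or_lt with rfl | hkj'
    · obtain ⟨z, hz, hz'⟩ := fin (v k) q hsk hqs (hbelow _ (by omega) (by omega)) (by simp)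
      exact ⟨k, by omega, z,
        (convex_segment _ _).segment_subset (left_mem_segment _ _ _) hq hz, hz'⟩
    · obtain ⟨m, hm1, hm2, hm3, hm4⟩ := exists_step_mem (x := fun i => (v i).1) hkj' hsk h1
      obtain ⟨z, hz, hz'⟩ := fin _ _ hm3 hm4 (hbelow _ (by omega) (by omega))
        (hbelow _ (by omega) (by omega))
      exact ⟨m, by omega, z, hz, hz'⟩

end Visibility

/-! ### Half guards covering a single valley -/

/-- The half guard on the horizontal edge of the mountain, above the vertex `v m`. -/
def topGuard (v : ℕ → ℝ × ℝ) (m : ℕ) (d : LookDir) : HalfGuard :=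
  ⟨((v m).1, (v 0).2), d⟩

/-- The half guard `g` sees every point of the `j`-th edge of the chain. -/
def SeesEdge (v : ℕ → ℝ × ℝ) (N : ℕ) (g : HalfGuard) (j : ℕ) : Prop :=
  ∀ q ∈ segment ℝ (v j) (v (j + 1)), g.Sees (chainRegion v N (v 0).2) q

namespace IsMountainChain

variable {v : ℕ → ℝ × ℝ} {N : ℕ}

theorem snd_le_of_descending {j m : ℕ} (hjm : j ≤ m)
    (hD : ∀ i, j ≤ i → i < m → (v (i + 1)).2 ≤ (v i).2) : (v m).2 ≤ (v j).2 := by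
  induction m, hjm using Nat.le_induction with
  | base => exact le_rfl
  | succ m hm ih => exact (hD m hm m.lt_succ_self).trans (ih fun i h h' => hD i h (by omega))

theorem snd_le_of_ascending {j m : ℕ} (hjm : j ≤ m)
    (hU : ∀ i, j ≤ i → i < m → (v i).2 ≤ (v (i + 1)).2) : (v j).2 ≤ (v m).2 := by
  induction m, hjm using Nat.le_induction with
  | base => exact le_rfl
  | succ m hm ih => exact (ih fun i h h' => hU i h (by omega)).trans (hU m hm m.lt_succ_self)

theorem snd_le_height (hc : IsMountainChain v N) {j : ℕ} (hj : j < N) {q : ℝ × ℝ}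
    (hq : q ∈ segment ℝ (v j) (v (j + 1))) : q.2 ≤ (v 0).2 := by
  obtain ⟨x, y, hx, hy, hxy, rfl⟩ := hq
  obtain rfl : x = 1 - y := by linarith
  have h1 := hc.le_height (j := j) (by omega)
  have h2 := hc.le_height (j := j + 1) (by omega)
  simp only [Prod.snd_add, Prod.smul_snd, smul_eq_mul]
  nlinarith

/-- A left-looking guard sees down a descending run, even from behind one arbitrary further
edge, at whose far end it is placed. -/
theorem seesEdge_left (hc : IsMountainChain v N) {j l : ℕ} (hjl : j < l) (hl : l ≤ N)
    (hD : ∀ i, j ≤ i → i + 1 < l → (v (i + 1)).2 ≤ (v i).2) :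
    SeesEdge v N (topGuard v l .left) j := by
  intro q hq
  have hqx := fst_mem_Icc_of_mem_segment hq (hc.monotone j (by omega))
  have hqh := hc.snd_le_height (by omega) hq
  have hxl : q.1 ≤ (v l).1 := hqx.2.trans (hc.le_of_le hjl hl)
  refine ⟨segment_subset_chainRegion_left hq hjl hl hxl hqh fun m hm hml => ?_, hxl⟩
  have hxm : q.1 ≤ (v m).1 := hqx.2.trans (hc.le_of_le hm (by omega))
  rcases hml.eq_or_lt with rfl | hml
  · have := hc.le_height hl
    nlinarith
  · have h1 : (v m).2 ≤ q.2 := by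
      have h2 := snd_le_of_descending (j := j + 1) (m := m) hm
        fun i hi hi' => hD i (by omega) (by omega)
      rw [segment_symm] at hq
      exact h2.trans (snd_mem_Icc_of_mem_segment hq (hD j le_rfl (by omega))).1
    nlinarith [mul_nonneg (sub_nonneg.2 hqh) (sub_nonneg.2 hxm),
      mul_nonneg (sub_nonneg.2 hxl) (sub_nonneg.2 h1)]

/-- The mirror image of `seesEdge_left`. -/
theorem seesEdge_right (hc : IsMountainChain v N) {j k : ℕ} (hkj : k ≤ j) (hj : j < N)
    (hU : ∀ i, k < i → i ≤ j → (v i).2 ≤ (v (i + 1)).2) :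
    SeesEdge v N (topGuard v k .right) j := by
  intro q hq
  have hqx := fst_mem_Icc_of_mem_segment hq (hc.monotone j (by omega))
  have hqh := hc.snd_le_height (by omega) hq
  have hxk : (v k).1 ≤ q.1 := (hc.le_of_le hkj (by omega)).trans hqx.1
  refine ⟨segment_subset_chainRegion_right hq hkj hj hxk hqh fun m hm hmj => ?_, hxk⟩
  have hxm : (v m).1 ≤ q.1 := (hc.le_of_le hmj (by omega)).trans hqx.1
  rcases hm.eq_or_lt with rfl | hm
  · have := hc.le_height (j := k) (by omega)
    nlinarith
  · have h1 : (v m).2 ≤ q.2 := by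
      have h2 := snd_le_of_ascending (j := m) (m := j) hmj
        fun i hi hi' => hU i (by omega) (by omega)
      exact h2.trans (snd_mem_Icc_of_mem_segment hq (hU j (by omega) le_rfl)).1
    nlinarith [mul_nonneg (sub_nonneg.2 hqh) (sub_nonneg.2 hxm),
      mul_nonneg (sub_nonneg.2 hxk) (sub_nonneg.2 h1)]

/-- Along a stretch of left turns, the edge directions turn left relative to one another, also for
edges that are not adjacent: as the chain is `x`-monotone, the total turning is at most `π`. -/
theorem cross_nonneg_of_convex (hc : IsMountainChain v N) {k l : ℕ} (hl : l ≤ N)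
    (hconv : ∀ j, k < j → j < l → 0 < turn (v (j - 1)) (v j) (v (j + 1))) {a b : ℕ}
    (hka : k ≤ a) (hab : a < b) (hbl : b < l) :
    0 ≤ ((v (a + 1)).1 - (v a).1) * ((v (b + 1)).2 - (v b).2) -
      ((v (a + 1)).2 - (v a).2) * ((v (b + 1)).1 - (v b).1) := by
  have step : ∀ c, k ≤ c → c + 1 < l →
      0 < ((v (c + 1)).1 - (v c).1) * ((v (c + 1 + 1)).2 - (v (c + 1)).2) -
        ((v (c + 1)).2 - (v c).2) * ((v (c + 1 + 1)).1 - (v (c + 1)).1) := by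
    intro c h1 h2
    have := hconv (c + 1) (by omega) h2
    rw [turn, Nat.add_sub_cancel] at this
    linarith
  induction b, hab using Nat.le_induction with
  | base => exact (step a hka hbl).le
  | succ b hb ih =>
    have h1 := ih (by omega)
    have h2 := step b (by omega) hbl
    have h3 := step (b - 1) (by omega) (by omega)
    rw [Nat.sub_add_cancel (by omega)] at h3
    have d0 := sub_nonneg.2 (hc.monotone (b - 1) (by omega))
    rw [Nat.sub_add_cancel (by omega)] at d0
    have d1 := sub_nonneg.2 (hc.monotone b (by omega))
    have d2 := sub_nonneg.2 (hc.monotone (b + 1) (by omega))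
    have da := sub_nonneg.2 (hc.monotone a (by omega))
    set u0 := (v b).1 - (v (b - 1)).1
    set w0 := (v b).2 - (v (b - 1)).2
    set u1 := (v (b + 1)).1 - (v b).1
    set w1 := (v (b + 1)).2 - (v b).2
    set u2 := (v (b + 1 + 1)).1 - (v (b + 1)).1
    set w2 := (v (b + 1 + 1)).2 - (v (b + 1)).2
    set ua := (v (a + 1)).1 - (v a).1
    set wa := (v (a + 1)).2 - (v a).2
    -- an edge between two left turns is not vertical
    have hpos : 0 < u1 := by
      refine d1.lt_of_ne fun h0 => ?_
      rw [← h0] at h2 h3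
      have : 0 < w1 := by
        by_contra! hw
        nlinarith
      nlinarith
    refine le_of_mul_le_mul_left ?_ hpos
    nlinarith [mul_nonneg h1 d2, mul_nonneg h2.le da]

theorem turn_nonneg_of_convex (hc : IsMountainChain v N) {k l : ℕ} (hl : l ≤ N)
    (hconv : ∀ j, k < j → j < l → 0 < turn (v (j - 1)) (v j) (v (j + 1))) {a b : ℕ}
    (hka : k ≤ a) (hab : a ≤ b) (hbl : b ≤ l) : 0 ≤ turn (v a) (v b) (v l) := by
  have right : ∀ a, k ≤ a → ∀ b, a < b → ∀ c, b ≤ c → c ≤ l →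
      0 ≤ ((v (a + 1)).1 - (v a).1) * ((v c).2 - (v b).2) -
        ((v (a + 1)).2 - (v a).2) * ((v c).1 - (v b).1) := by
    intro a ha b hab c hbc
    induction c, hbc using Nat.le_induction with
    | base => intro _; simp
    | succ c hbc ih =>
      intro hcl
      have h1 := ih (by omega)
      have h2 := hc.cross_nonneg_of_convex hl hconv ha (by omega : a < c) (by omega)
      linarith
  have left : 0 ≤ ((v b).1 - (v a).1) * ((v l).2 - (v b).2) -
        ((v b).2 - (v a).2) * ((v l).1 - (v b).1) := by
    induction hab using Nat.decreasingInduction with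
    | self => simp
    | of_succ a hab ih =>
      have h1 := ih (by omega)
      have h2 := right a hka b hab l hbl le_rfl
      linarith
  rw [turn]
  linarith

/-- The part of the region above a stretch of left turns is convex, so a single guard sees it. -/
theorem seesEdge_of_convex (hc : IsMountainChain v N) {j k l : ℕ} (hkj : k ≤ j) (hjl : j < l)
    (hl : l ≤ N) (hconv : ∀ j, k < j → j < l → 0 < turn (v (j - 1)) (v j) (v (j + 1))) :
    SeesEdge v N (topGuard v l .left) j := by
  intro q hq
  have hqx := fst_mem_Icc_of_mem_segment hq (hc.monotone j (by omega))
  have hqh := hc.snd_le_height (by omega) hq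
  have hxl : q.1 ≤ (v l).1 := hqx.2.trans (hc.le_of_le hjl hl)
  refine ⟨segment_subset_chainRegion_left hq hjl hl hxl hqh fun m hm hml => ?_, hxl⟩
  have hxm : q.1 ≤ (v m).1 := hqx.2.trans (hc.le_of_le hm (by omega))
  have h1 := hc.turn_nonneg_of_convex hl hconv hkj hm.le hml
  have h2 := hc.turn_nonneg_of_convex hl hconv (by omega : k ≤ j + 1) hm hml
  have h3 : 0 ≤ turn q (v m) (v l) := by
    obtain ⟨x, y, hx, hy, hxy, rfl⟩ := hq
    have : turn (x • v j + y • v (j + 1)) (v m) (v l) =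
        x * turn (v j) (v m) (v l) + y * turn (v (j + 1)) (v m) (v l) := by
      obtain rfl : x = 1 - y := by linarith
      simp only [turn, Prod.snd_add, Prod.smul_snd, smul_eq_mul, Prod.fst_add, Prod.smul_fst]
      ring
    rw [this]
    positivity
  rw [turn] at h3
  have h4 := hc.le_height hl
  nlinarith [mul_nonneg (sub_nonneg.2 h4) (sub_nonneg.2 hxm)]

/-- A valley consists of a descending run from `v k` to `v i` and an ascending run from `v i` to
`v l`. Two guards always see it; a single one does if one of the two runs is a single edge or if
there is no reflex vertex inside. -/
theorem exists_guards_valley (hc : IsMountainChain v N) {k i l : ℕ} (hki : k < i) (hil : i < l)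
    (hl : l ≤ N) (hD : ∀ j, k ≤ j → j < i → (v (j + 1)).2 ≤ (v j).2)
    (hU : ∀ j, i ≤ j → j < l → (v j).2 < (v (j + 1)).2) :
    ∃ G : Finset HalfGuard, (∀ g ∈ G, ∃ m ≤ N, ∃ d, g = topGuard v m d) ∧
      (∀ j, k ≤ j → j < l → ∃ g ∈ G, SeesEdge v N g j) ∧
      2 * G.card ≤ l - k ∧ G.card ≤ (reflexIn v k l).card + 1 ∧ G.card ≤ 2 := by
  classical
  have single : ∀ m ≤ N, ∀ d, (∀ j, k ≤ j → j < l → SeesEdge v N (topGuard v m d) j) →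
      ∃ G : Finset HalfGuard, (∀ g ∈ G, ∃ m ≤ N, ∃ d, g = topGuard v m d) ∧
      (∀ j, k ≤ j → j < l → ∃ g ∈ G, SeesEdge v N g j) ∧
      2 * G.card ≤ l - k ∧ G.card ≤ (reflexIn v k l).card + 1 ∧ G.card ≤ 2 := by
    intro m hm d hsee
    refine ⟨{topGuard v m d}, ?_, ?_, ?_, ?_, ?_⟩
    · simpa using ⟨m, hm, d, rfl⟩
    · simpa using hsee
    all_goals rw [Finset.card_singleton]; omega
  by_cases hconv : ∀ j, k < j → j < l → 0 < turn (v (j - 1)) (v j) (v (j + 1))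
  · exact single l hl .left fun j h1 h2 => hc.seesEdge_of_convex h1 h2 hl hconv
  by_cases h1 : l = i + 1
  · exact single l hl .left fun j hj hj' =>
      hc.seesEdge_left hj' hl fun m hm hm' => hD m (by omega) (by omega)
  by_cases h2 : i = k + 1
  · exact single k (by omega) .right fun j hj hj' =>
      hc.seesEdge_right hj (by omega) fun m hm hm' => (hU m (by omega) (by omega)).le
  refine ⟨{topGuard v i .left, topGuard v i .right}, ?_, ?_, ?_, ?_, Finset.card_le_two⟩
  · simp only [Finset.mem_insert, Finset.mem_singleton, forall_eq_or_imp, forall_eq]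
    exact ⟨⟨i, by omega, _, rfl⟩, ⟨i, by omega, _, rfl⟩⟩
  · intro j hj hj'
    rcases lt_or_ge j i with h | h
    · exact ⟨_, Finset.mem_insert_self _ _, hc.seesEdge_left h (by omega)
        fun m hm hm' => hD m (by omega) (by omega)⟩
    · exact ⟨_, Finset.mem_insert_of_mem (Finset.mem_singleton_self _),
        hc.seesEdge_right h (by omega) fun m hm hm' => (hU m (by omega) (by omega)).le⟩
  · have := Finset.card_le_two (a := topGuard v i .left) (b := topGuard v i .right)
    omega
  · push Not at hconv
    obtain ⟨j, hj, hj', hturn⟩ := hconv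
    have hmem : j ∈ reflexIn v k l := Finset.mem_filter.2
      ⟨Finset.mem_Ioo.2 ⟨hj, hj'⟩, hturn.lt_of_ne (hc.turn_ne j (by omega) (by omega))⟩
    have := Finset.card_pos.2 ⟨j, hmem⟩
    have := Finset.card_le_two (a := topGuard v i .left) (b := topGuard v i .right)
    omega

/-! ### Covering the whole mountain valley by valley -/

theorem turn_pos_of_bottom (hc : IsMountainChain v N) {i : ℕ} (h0 : 0 < i) (hi : i < N)
    (hD : (v i).2 ≤ (v (i - 1)).2) (hU : (v i).2 < (v (i + 1)).2) :
    0 < turn (v (i - 1)) (v i) (v (i + 1)) := by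
  have h1 := hc.monotone (i - 1) (by omega)
  rw [Nat.sub_add_cancel h0] at h1
  have h2 := hc.monotone i hi
  refine lt_of_le_of_ne ?_ (hc.turn_ne i h0 hi).symm
  rw [turn]
  nlinarith [mul_nonneg (sub_nonneg.2 h1) (sub_nonneg.2 hU.le),
    mul_nonneg (sub_nonneg.2 hD) (sub_nonneg.2 h2)]

theorem turn_neg_of_peak (hc : IsMountainChain v N) {i : ℕ} (h0 : 0 < i) (hi : i < N)
    (hU : (v (i - 1)).2 < (v i).2) (hD : (v (i + 1)).2 ≤ (v i).2) :
    turn (v (i - 1)) (v i) (v (i + 1)) < 0 := by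
  have h1 := hc.monotone (i - 1) (by omega)
  rw [Nat.sub_add_cancel h0] at h1
  have h2 := hc.monotone i hi
  refine lt_of_le_of_ne ?_ (hc.turn_ne i h0 hi)
  rw [turn]
  nlinarith [mul_nonneg (sub_nonneg.2 h1) (sub_nonneg.2 hD),
    mul_nonneg (sub_nonneg.2 hU.le) (sub_nonneg.2 h2)]

/-- All three upper bounds hold at once for the part of the mountain to the right of a vertex at
which a descending run starts. -/
theorem exists_guards_from (hc : IsMountainChain v N) (k : ℕ) (hk : k < N)
    (hDk : (v (k + 1)).2 ≤ (v k).2) :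
    ∃ G : Finset HalfGuard, (∀ g ∈ G, ∃ m ≤ N, ∃ d, g = topGuard v m d) ∧
      (∀ j, k ≤ j → j < N → ∃ g ∈ G, SeesEdge v N g j) ∧
      2 * G.card ≤ N - k ∧ G.card ≤ (reflexIn v k N).card + 1 ∧
      G.card ≤ 2 * (convexIn v k N).card := by
  classical
  induction hd : N - k using Nat.strong_induction_on generalizing k with
  | _ d ih =>
  subst hd
  have hN := hc.two_le
  have hlast : (v (N - 1)).2 < (v (N - 1 + 1)).2 := by
    rw [Nat.sub_add_cancel (by omega), hc.horizontal]
    exact hc.below _ (by omega) (by omega)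
  -- the bottom `i` of the first valley, and its right end `l`
  have hexi : ∃ i, k ≤ i ∧ (v i).2 < (v (i + 1)).2 := ⟨N - 1, by omega, hlast⟩
  obtain ⟨hki, hUi⟩ := Nat.find_spec hexi
  have hiN : Nat.find hexi ≤ N - 1 := Nat.find_min' hexi ⟨by omega, hlast⟩
  have hD : ∀ j, k ≤ j → j < Nat.find hexi → (v (j + 1)).2 ≤ (v j).2 := by
    intro j hj hji
    have := Nat.find_min hexi hji
    push Not at this
    exact this hj
  generalize Nat.find hexi = i at hki hUi hiN hD
  have hki' : k < i := by
    rcases hki.eq_or_lt with rfl | h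
    · exact absurd hUi hDk.not_gt
    · exact h
  have hexl : ∃ l, i < l ∧ (N ≤ l ∨ (v (l + 1)).2 ≤ (v l).2) := ⟨N, by omega, Or.inl le_rfl⟩
  obtain ⟨hil, hl⟩ := Nat.find_spec hexl
  have hlN : Nat.find hexl ≤ N := Nat.find_min' hexl ⟨by omega, Or.inl le_rfl⟩
  have hU : ∀ j, i ≤ j → j < Nat.find hexl → (v j).2 < (v (j + 1)).2 := by
    intro j hj hjl
    rcases hj.eq_or_lt with rfl | hj
    · exact hUi
    · have := Nat.find_min hexl hjl
      push Not at this
      exact (this hj).2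
  generalize Nat.find hexl = l at hil hl hlN hU
  obtain ⟨G, hG, hsee, hc1, hc2, hc3⟩ := hc.exists_guards_valley hki' hil hlN hD hU
  have hbot : i ∈ convexIn v k l := by
    refine Finset.mem_filter.2 ⟨Finset.mem_Ioo.2 ⟨hki', hil⟩,
      hc.turn_pos_of_bottom (by omega) (by omega) ?_ hUi⟩
    have := hD (i - 1) (by omega) (by omega)
    rwa [Nat.sub_add_cancel (by omega)] at this
  rcases hlN.eq_or_lt with rfl | hlN
  · refine ⟨G, hG, hsee, hc1, hc2, ?_⟩
    have := Finset.card_pos.2 ⟨i, hbot⟩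
    omega
  have hDl : (v (l + 1)).2 ≤ (v l).2 := hl.resolve_left (by omega)
  obtain ⟨G', hG', hsee', hc1', hc2', hc3'⟩ := ih (N - l) (by omega) l hlN hDl rfl
  refine ⟨G ∪ G', ?_, ?_, ?_, ?_, ?_⟩
  · intro g hg
    rcases Finset.mem_union.1 hg with h | h
    exacts [hG g h, hG' g h]
  · intro j hj hjN
    rcases lt_or_ge j l with h | h
    · obtain ⟨g, hg, hs⟩ := hsee j hj h
      exact ⟨g, Finset.mem_union_left _ hg, hs⟩
    · obtain ⟨g, hg, hs⟩ := hsee' j h hjN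
      exact ⟨g, Finset.mem_union_right _ hg, hs⟩
  · have := Finset.card_union_le G G'
    omega
  · -- the peak `l` is a reflex vertex that separates the two parts
    have hpeak := hc.turn_neg_of_peak (i := l) (by omega) hlN
      (by
        have := hU (l - 1) (by omega) (by omega)
        rwa [Nat.sub_add_cancel (by omega)] at this) hDl
    have hsub : insert l (reflexIn v k l ∪ reflexIn v l N) ⊆ reflexIn v k N := by
      intro j hj
      simp only [reflexIn, Finset.mem_insert, Finset.mem_union, Finset.mem_filter,
        Finset.mem_Ioo] at hj ⊢
      rcases hj with rfl | ⟨⟨h1, h2⟩, h3⟩ | ⟨⟨h1, h2⟩, h3⟩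
      exacts [⟨⟨by omega, hlN⟩, hpeak⟩, ⟨⟨h1, by omega⟩, h3⟩, ⟨⟨by omega, h2⟩, h3⟩]
    have hdisj : Disjoint (reflexIn v k l) (reflexIn v l N) := by
      rw [Finset.disjoint_left]
      intro j h1 h2
      simp only [reflexIn, Finset.mem_filter, Finset.mem_Ioo] at h1 h2
      omega
    have hcard := Finset.card_le_card hsub
    rw [Finset.card_insert_of_notMem (by simp [reflexIn]),
      Finset.card_union_of_disjoint hdisj] at hcard
    have := Finset.card_union_le G G'
    omega
  · have hsub : insert i (convexIn v l N) ⊆ convexIn v k N := by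
      intro j hj
      simp only [convexIn, Finset.mem_insert, Finset.mem_filter, Finset.mem_Ioo] at hj hbot ⊢
      rcases hj with rfl | ⟨⟨h1, h2⟩, h3⟩
      exacts [⟨⟨hki', by omega⟩, hbot.2⟩, ⟨⟨by omega, h2⟩, h3⟩]
    have hcard := Finset.card_le_card hsub
    rw [Finset.card_insert_of_notMem (by
      simp only [convexIn, Finset.mem_filter, Finset.mem_Ioo]; omega)] at hcard
    have := Finset.card_union_le G G'
    omega

theorem card_reflexIn_add_card_convexIn (hc : IsMountainChain v N) :
    (reflexIn v 0 N).card + (convexIn v 0 N).card = N - 1 := by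
  have h : convexIn v 0 N =
      {j ∈ Finset.Ioo 0 N | ¬ turn (v (j - 1)) (v j) (v (j + 1)) < 0} := by
    refine Finset.filter_congr fun j hj => ?_
    rw [Finset.mem_Ioo] at hj
    rw [not_lt]
    exact ⟨le_of_lt, fun h => h.lt_of_ne (hc.turn_ne j hj.1 hj.2).symm⟩
  rw [h, reflexIn, Finset.card_filter_add_card_filter_not, Nat.card_Ioo]
  omega

end IsMountainChain

/-- The three upper bounds, for one and the same set of half guards. -/
theorem exists_cover {N : ℕ} [NeZero (N + 1)] {P : Polygon (ℝ × ℝ) (N + 1)}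
    (hP : P.IsMonotoneMountain) :
    ∃ G : Finset HalfGuard, P.IsHalfGuardCover G ∧ 2 * G.card ≤ N ∧
      G.card ≤ P.reflexCount + 1 ∧ G.card ≤ 2 * (N - 1 - P.reflexCount) := by
  obtain ⟨v, hv⟩ : ∃ v : ℕ → ℝ × ℝ, ∀ i : Fin (N + 1), P i = v i :=
    ⟨fun j => P (Fin.ofNat (N + 1) j), fun i => by simp⟩
  have hc := isMountainChain_of_isMonotoneMountain hv hP
  have hN := hc.two_le
  obtain ⟨G, hG, hsee, h1, h2, h3⟩ := hc.exists_guards_from 0 (by omega)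
    (hc.le_height (by omega))
  rw [← hc.reflexCount_eq hv] at h2
  have hsum := hc.card_reflexIn_add_card_convexIn
  rw [← hc.reflexCount_eq hv] at hsum
  refine ⟨G, ⟨?_, ?_⟩, by omega, h2, by omega⟩
  · intro g hg
    obtain ⟨m, hm, d, rfl⟩ := hG g hg
    rw [region_eq_chainRegion hv]
    refine ⟨le_rfl, ?_⟩
    rcases hm.eq_or_lt with rfl | hm
    · refine ⟨m - 1, by omega, v m, ?_, rfl, hc.le_height le_rfl⟩
      rw [Nat.sub_add_cancel (by omega)]
      exact right_mem_segment _ _ _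
    · exact ⟨m, hm, v m, left_mem_segment _ _ _, rfl, hc.le_height hm.le⟩
  · rw [region_eq_chainRegion hv]
    rintro p ⟨hp, j, hj, q, hq, hqp, hle⟩
    obtain ⟨g, hg, hs⟩ := hsee j (by omega) hj
    obtain ⟨hseg, hface⟩ := hs q hq
    obtain ⟨m, hm, d, rfl⟩ := hG g hg
    refine ⟨_, hg, segment_subset_chainRegion_of_le le_rfl hp hqp hle hseg, ?_⟩
    cases d <;> simpa [HalfGuard.Faces, topGuard, hqp] using hface

/-! ### Mountains with vertices at integer abscissas -/

/-- The chain whose vertices lie at the integer abscissas `0, 1, 2, …`, at the heights `y`. -/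
def graphChain (y : ℕ → ℝ) (j : ℕ) : ℝ × ℝ := (j, y j)

/-- For unit steps, the turn at a vertex is the second difference of the heights. -/
theorem turn_graphChain (y : ℕ → ℝ) {j : ℕ} (hj : 0 < j) :
    turn (graphChain y (j - 1)) (graphChain y j) (graphChain y (j + 1)) =
      y (j + 1) - 2 * y j + y (j - 1) := by
  simp only [turn, graphChain]
  rw [Nat.cast_sub (by omega)]
  push_cast
  ring

theorem le_snd_of_mem_chainRegion {y : ℕ → ℝ} {N j : ℕ} {h : ℝ} {p : ℝ × ℝ}
    (hp : p ∈ chainRegion (graphChain y) N h) (hj : p.1 = j) : y j ≤ p.2 := by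
  obtain ⟨-, i, -, q, ⟨a, b, ha, hb, hab, rfl⟩, h1, h2⟩ := hp
  refine le_trans ?_ h2
  obtain rfl : a = 1 - b := by linarith
  simp only [graphChain, Prod.snd_add, Prod.smul_snd, smul_eq_mul, Prod.fst_add, Prod.smul_fst,
    hj] at h1 ⊢
  push_cast at h1
  have h3 : (j : ℝ) = i + b := by linarith
  have h4 : i ≤ j := by
    have : (i : ℝ) ≤ j := by linarith
    exact_mod_cast this
  have h5 : j ≤ i + 1 := by
    have : (j : ℝ) ≤ i + 1 := by linarith
    exact_mod_cast this
  rcases Nat.le_succ_iff.1 h5 with h6 | rfl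
  · obtain rfl : i = j := le_antisymm h4 h6
    obtain rfl : b = 0 := by linarith
    simp
  · obtain rfl : b = 1 := by push_cast at h3; linarith
    simp

/-- A line of sight passes above every vertex that it crosses. -/
theorem le_of_segment_subset {y : ℕ → ℝ} {N j : ℕ} {h : ℝ} {p q : ℝ × ℝ}
    (hs : segment ℝ p q ⊆ chainRegion (graphChain y) N h) (hp : p.1 ≤ j) (hq : j ≤ q.1) :
    (q.1 - p.1) * y j ≤ (q.1 - j) * p.2 + (j - p.1) * q.2 := by
  obtain ⟨z, hz, hz1, hlin⟩ := exists_mem_segment_fst_eq hp hq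
  have h1 := le_snd_of_mem_chainRegion (hs hz) hz1
  have h2 := hlin (q.1 - p.1) (p.2 - q.2) (q.1 * p.2 - p.1 * q.2) (by linarith) (by linarith)
  rw [hz1] at h2
  have := mul_le_mul_of_nonneg_left h1 (by linarith : 0 ≤ q.1 - p.1)
  linarith

/-! ### A family of mountains that need many half guards -/

/-- The heights of the lower chain in the worst case examples. After the prefix `π` of length `e`
there are `t` wide valleys with the heights `75, 0, 75`, and then narrow valleys of height `0`; the
peaks between the valleys have height `99`, and the horizontal edge has height `100`. -/
noncomputable def profile (π : ℕ → ℝ) (e t N : ℕ) (j : ℕ) : ℝ :=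
  if j ≤ e then π j
  else if N ≤ j then 100
  else if (j - e < 4 * t ∧ (j - e) % 4 = 2) ∨ (4 * t < j - e ∧ (j - e) % 2 = 1) then 0
  else if (j - e) % 2 = 1 then 75
  else 99

/-- The left end of the `i`-th valley, where the first `t` valleys have width `4` and all others
have width `2`. -/
def peak (e t i : ℕ) : ℕ := e + 2 * i + 2 * min i t

/-- The lowest vertex of the `i`-th valley. -/
def bottom (e t i : ℕ) : ℕ := peak e t i + if i < t then 2 else 1

/-- The points of the `i`-th valley that are hard to see: the bottom, and in a wide valley also a
point above each of the two outer edges. -/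
noncomputable def witnesses (e t i : ℕ) : Set (ℝ × ℝ) :=
  {p | p = ((bottom e t i : ℝ), 0) ∨ i < t ∧ p = ((peak e t i : ℝ) + 1 / 2, 87.5) ∨
    i < t ∧ p = ((peak e t i : ℝ) + 7 / 2, 87.5)}

section Family

variable {π : ℕ → ℝ} {e t s N : ℕ}

theorem profile_bottom {i : ℕ} (hi : i < t + s) (hN : N = e + 4 * t + 2 * s) :
    profile π e t N (bottom e t i) = 0 := by
  unfold profile bottom peak
  split_ifs <;> first | rfl | omega

theorem profile_peak {i : ℕ} (hi0 : 0 < i) (hi : i < t + s) (hN : N = e + 4 * t + 2 * s) :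
    profile π e t N (peak e t i) = 99 := by
  unfold profile peak
  split_ifs <;> first | rfl | omega

theorem profile_side {i : ℕ} (hi : i < t) (hN : N = e + 4 * t + 2 * s) :
    profile π e t N (peak e t i + 1) = 75 ∧ profile π e t N (peak e t i + 3) = 75 := by
  unfold profile peak
  constructor <;> split_ifs <;> first | rfl | omega

theorem profile_lt {j : ℕ} (hπ : ∀ j, 0 < j → j ≤ e → π j < 100) (hj0 : 0 < j) (hj : j < N) :
    profile π e t N j < 100 := by
  unfold profile
  split_ifs with h1
  · exact hπ j hj0 h1
  · omega
  all_goals norm_num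

theorem profile_nonneg {j : ℕ} (hπ : ∀ j ≤ e, 0 < π j) : 0 ≤ profile π e t N j := by
  unfold profile
  split_ifs with h1
  · exact (hπ j h1).le
  all_goals norm_num

theorem peak_succ_le {i i' : ℕ} (h : i < i') : peak e t (i + 1) ≤ peak e t i' := by
  unfold peak; omega

theorem turn_bottom_pos {j : ℕ} (hπ : ∀ j ≤ e, 0 < π j) (hN : N = e + 4 * t + 2 * s)
    {i : ℕ} (hi : i < t + s) (hj : j = bottom e t i) :
    0 < profile π e t N (j + 1) - 2 * profile π e t N j + profile π e t N (j - 1) := by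
  have h0 : profile π e t N j = 0 := by rw [hj]; exact profile_bottom hi hN
  have h1 := profile_nonneg (t := t) (N := N) (j := j - 1) hπ
  have h2 : 0 < profile π e t N (j + 1) := by
    unfold bottom peak at hj
    unfold profile
    split_ifs at hj ⊢ with h h' <;> first | norm_num; done | omega
  linarith

theorem turn_neg_of_ne_bottom {j : ℕ} (hπ0 : π 0 = 100) (hπ : ∀ j, 0 < j → j ≤ e → π j < 100)
    (hN : N = e + 4 * t + 2 * s) (hej : e < j) (hjN : j < N)
    (hb : ∀ i < t + s, j ≠ bottom e t i) :
    profile π e t N (j + 1) - 2 * profile π e t N j + profile π e t N (j - 1) < 0 := by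
  have hnb : ¬ ((j - e < 4 * t ∧ (j - e) % 4 = 2) ∨ (4 * t < j - e ∧ (j - e) % 2 = 1)) := by
    rintro (⟨h1, h2⟩ | ⟨h1, h2⟩)
    · refine hb ((j - e) / 4) (by omega) ?_
      unfold bottom peak
      split_ifs <;> omega
    · refine hb (t + (j - e - 4 * t) / 2) (by omega) ?_
      unfold bottom peak
      split_ifs <;> omega
  have hle : ∀ i ≤ N, profile π e t N i ≤ 100 := by
    intro i hi
    rcases Nat.eq_zero_or_pos i with rfl | h0
    · simp [profile, hπ0]
    rcases hi.eq_or_lt with rfl | hi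
    · unfold profile
      rw [if_neg (by omega), if_pos le_rfl]
    · exact (profile_lt hπ h0 hi).le
  have hval : profile π e t N j = if (j - e) % 2 = 1 then 75 else 99 := by
    unfold profile
    rw [if_neg (by omega), if_neg (by omega), if_neg hnb]
  rcases Nat.mod_two_eq_zero_or_one (j - e) with h | h
  · -- a peak: both neighbours have height at most `75`
    have hodd : ∀ i, e < i → i < N → (i - e) % 2 = 1 → profile π e t N i ≤ 75 := by
      intro i h1 h2 h3
      unfold profile
      rw [if_neg (by omega), if_neg (by omega)]
      split_ifs <;> norm_num
    have h1 := hodd (j + 1) (by omega) (by omega) (by omega)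
    have h2 := hodd (j - 1) (by omega) (by omega) (by omega)
    rw [hval, if_neg (by omega)]
    linarith
  · -- the side of a wide valley: one of the neighbours is the bottom
    rw [hval, if_pos h]
    have h4 : (j - e) % 4 = 1 ∨ (j - e) % 4 = 3 := by omega
    rcases h4 with h4 | h4
    · have h1 : profile π e t N (j + 1) = 0 := by
        unfold profile
        rw [if_neg (by omega), if_neg (by omega), if_pos (by omega)]
      have h2 := hle (j - 1) (by omega)
      rw [h1]; linarith
    · have h1 : profile π e t N (j - 1) = 0 := by
        unfold profile
        rw [if_neg (by omega), if_neg (by omega), if_pos (by omega)]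
      have h2 := hle (j + 1) (by omega)
      rw [h1]; linarith

theorem reflexIn_profile {c : ℕ} (hπ0 : π 0 = 100) (hπpos : ∀ j ≤ e, 0 < π j)
    (hπ : ∀ j, 0 < j → j ≤ e → π j < 100) (hN : N = e + 4 * t + 2 * s)
    (hleft : ∀ j, 0 < j → j ≤ c →
      0 < profile π e t N (j + 1) - 2 * profile π e t N j + profile π e t N (j - 1))
    (hright : ∀ j, c < j → j ≤ e →
      profile π e t N (j + 1) - 2 * profile π e t N j + profile π e t N (j - 1) < 0) :
    reflexIn (graphChain (profile π e t N)) 0 N =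
      Finset.Ioo c N \ (Finset.range (t + s)).image (bottom e t) := by
  ext j
  simp only [reflexIn, Finset.mem_filter, Finset.mem_Ioo, Finset.mem_sdiff, Finset.mem_image,
    Finset.mem_range, not_exists, not_and]
  constructor
  · rintro ⟨⟨h0, hjN⟩, hneg⟩
    rw [turn_graphChain _ h0] at hneg
    refine ⟨⟨?_, hjN⟩, fun i hi hij => ?_⟩
    · by_contra! h
      exact (hleft j h0 h).not_gt hneg
    · exact (turn_bottom_pos hπpos hN hi hij.symm).not_gt hneg
  · rintro ⟨⟨hcj, hjN⟩, hb⟩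
    have h0 : 0 < j := by omega
    refine ⟨⟨h0, hjN⟩, ?_⟩
    rw [turn_graphChain _ h0]
    rcases le_or_gt j e with h | h
    · exact hright j hcj h
    · exact turn_neg_of_ne_bottom hπ0 hπ hN h hjN fun i hi hij => hb i hi hij.symm

theorem bottom_injective : Function.Injective (bottom e t) := by
  intro i i' h
  unfold bottom peak at h
  split_ifs at h <;> omega

theorem card_reflexIn_profile {c : ℕ} (hN : N = e + 4 * t + 2 * s) (hce : c ≤ e)
    (hm : 0 < t + s) :
    (Finset.Ioo c N \ (Finset.range (t + s)).image (bottom e t)).card =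
      N - 1 - c - (t + s) := by
  rw [Finset.card_sdiff_of_subset, Finset.card_image_of_injective _ bottom_injective,
    Finset.card_range, Nat.card_Ioo]
  · omega
  · intro j hj
    obtain ⟨i, hi, rfl⟩ := Finset.mem_image.1 hj
    rw [Finset.mem_range] at hi
    rw [Finset.mem_Ioo]
    unfold bottom peak
    split_ifs <;> omega

theorem witnesses_bounds {i : ℕ} {w : ℝ × ℝ} (hw : w ∈ witnesses e t i) :
    (peak e t i : ℝ) + 1 / 2 ≤ w.1 ∧ w.1 ≤ peak e t i + 7 / 2 ∧
      w.1 ≤ (peak e t (i + 1) : ℝ) - 1 / 2 ∧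
      (peak e t (i + 1) : ℝ) ≤ w.1 + 7 / 2 ∧ w.2 ≤ 87.5 := by
  by_cases hi : i < t
  · have h1 : (peak e t (i + 1) : ℝ) = peak e t i + 4 := by
      have : peak e t (i + 1) = peak e t i + 4 := by unfold peak; omega
      exact_mod_cast this
    have h2 : (bottom e t i : ℝ) = peak e t i + 2 := by
      simp [bottom, hi]
    rw [h1]
    rcases hw with rfl | ⟨-, rfl⟩ | ⟨-, rfl⟩
    · rw [h2]; refine ⟨?_, ?_, ?_, ?_, ?_⟩ <;> dsimp only <;> linarith
    all_goals refine ⟨?_, ?_, ?_, ?_, ?_⟩ <;> dsimp only <;> linarith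
  · have h1 : (peak e t (i + 1) : ℝ) = peak e t i + 2 := by
      have : peak e t (i + 1) = peak e t i + 2 := by unfold peak; omega
      exact_mod_cast this
    have h2 : (bottom e t i : ℝ) = peak e t i + 1 := by
      simp [bottom, hi]
    rw [h1]
    rcases hw with rfl | ⟨h, -⟩ | ⟨h, -⟩
    · rw [h2]; refine ⟨?_, ?_, ?_, ?_, ?_⟩ <;> dsimp only <;> linarith
    all_goals exact absurd h hi

/-- No half guard sees witnesses in two different valleys: looking over a peak of height `99` from
height at most `100`, it would have to stand too close to that peak. -/
theorem not_sees_two_valleys (hN : N = e + 4 * t + 2 * s) {i i' : ℕ} (hii : i < i')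
    (hi' : i' < t + s) {w w' : ℝ × ℝ} (hw : w ∈ witnesses e t i) (hw' : w' ∈ witnesses e t i')
    {g : HalfGuard} (hg : g.pos.2 ≤ 100)
    (h : g.Sees (chainRegion (graphChain (profile π e t N)) N 100) w)
    (h' : g.Sees (chainRegion (graphChain (profile π e t N)) N 100) w') : False := by
  obtain ⟨a1, a2, a3, a4, a5⟩ := witnesses_bounds hw
  obtain ⟨b1, b2, b3, b4, b5⟩ := witnesses_bounds hw'
  have hpp : (peak e t (i + 1) : ℝ) ≤ peak e t i' := by exact_mod_cast peak_succ_le hii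
  obtain ⟨⟨gx, gy⟩, d⟩ := g
  cases d with
  | left =>
    have hface : w'.1 ≤ gx := h'.2
    have hs := h.1
    rw [segment_symm] at hs
    have := le_of_segment_subset (j := peak e t (i + 1)) hs (by linarith)
      (by change _ ≤ gx; linarith)
    rw [profile_peak (by omega) (by omega) hN] at this
    simp only at this hg
    have h1 : (peak e t (i + 1) - w.1) * gy ≤ (peak e t (i + 1) - w.1) * 100 :=
      mul_le_mul_of_nonneg_left hg (by linarith)
    have h2 : (gx - peak e t (i + 1)) * w.2 ≤ (gx - peak e t (i + 1)) * 87.5 :=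
      mul_le_mul_of_nonneg_left a5 (by linarith)
    linarith
  | right =>
    have hface : gx ≤ w.1 := h.2
    have := le_of_segment_subset (j := peak e t i') h'.1 (by change gx ≤ _; linarith)
      (by linarith)
    rw [profile_peak (by omega) hi' hN] at this
    simp only at this hg
    have h1 : (w'.1 - peak e t i') * gy ≤ (w'.1 - peak e t i') * 100 :=
      mul_le_mul_of_nonneg_left hg (by linarith)
    have h2 : (peak e t i' - gx) * w'.2 ≤ (peak e t i' - gx) * 87.5 :=
      mul_le_mul_of_nonneg_left b5 (by linarith)
    linarith

/-- No half guard sees all three witnesses of a wide valley: if it looks left and sees the one on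
the right-hand side, then the reflex vertex there hides the bottom. -/
theorem not_sees_wide_valley (hN : N = e + 4 * t + 2 * s) {i : ℕ} (hi : i < t)
    {g : HalfGuard} (hg : g.pos.2 ≤ 100)
    (h : ∀ w ∈ witnesses e t i,
      g.Sees (chainRegion (graphChain (profile π e t N)) N 100) w) : False := by
  have hb : (bottom e t i : ℝ) = peak e t i + 2 := by simp [bottom, hi]
  have h0 := h _ (Or.inl rfl)
  have h1 := h _ (Or.inr (Or.inl ⟨hi, rfl⟩))
  have h2 := h _ (Or.inr (Or.inr ⟨hi, rfl⟩))
  rw [hb] at h0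
  obtain ⟨hs1, hs3⟩ := profile_side (π := π) hi hN
  obtain ⟨⟨gx, gy⟩, d⟩ := g
  simp only at hg
  cases d with
  | left =>
    have hface : (peak e t i : ℝ) + 7 / 2 ≤ gx := h2.2
    have hs := h0.1
    rw [segment_symm] at hs
    have := le_of_segment_subset (j := peak e t i + 3) hs (by push_cast; linarith)
      (by push_cast; linarith)
    rw [hs3] at this
    push_cast at this
    linarith
  | right =>
    have hface : gx ≤ (peak e t i : ℝ) + 1 / 2 := h1.2
    have := le_of_segment_subset (j := peak e t i + 1) h0.1
      (by push_cast; linarith) (by push_cast; linarith)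
    rw [hs1] at this
    push_cast at this
    linarith

theorem witnesses_subset (hπ0 : π 0 = 100) (hπ : ∀ j, 0 < j → j ≤ e → π j < 100)
    (hN : N = e + 4 * t + 2 * s) {i : ℕ} (hi : i < t + s) :
    witnesses e t i ⊆ chainRegion (graphChain (profile π e t N)) N 100 := by
  have hle : ∀ j ≤ N, profile π e t N j ≤ 100 := by
    intro j hj
    rcases Nat.eq_zero_or_pos j with rfl | h0
    · simp [profile, hπ0]
    rcases hj.eq_or_lt with rfl | hj
    · unfold profile
      rw [if_neg (by omega), if_pos le_rfl]
    · exact (profile_lt hπ h0 hj).le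
  have hmid : ∀ j < N, ∃ q ∈ segment ℝ (graphChain (profile π e t N) j)
      (graphChain (profile π e t N) (j + 1)), q.1 = j + 1 / 2 ∧
      q.2 = (profile π e t N j + profile π e t N (j + 1)) / 2 := by
    intro j hj
    refine ⟨_, ⟨1 / 2, 1 / 2, by norm_num, by norm_num, by norm_num, rfl⟩, ?_, ?_⟩
    · simp [graphChain]; ring
    · simp [graphChain]; ring
  rintro w (rfl | ⟨hit, rfl⟩ | ⟨hit, rfl⟩)
  · refine ⟨by norm_num, bottom e t i, ?_, _, left_mem_segment _ _ _, rfl,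
      (profile_bottom hi hN).le⟩
    unfold bottom peak
    split_ifs <;> omega
  · have hp : peak e t i < N := by unfold peak; omega
    obtain ⟨q, hq, hq1, hq2⟩ := hmid (peak e t i) hp
    refine ⟨by norm_num, peak e t i, hp, q, hq, hq1, ?_⟩
    rw [hq2, (profile_side hit hN).1]
    have := hle _ hp.le
    norm_num
    linarith
  · have hp : peak e t i + 4 ≤ N := by unfold peak; omega
    obtain ⟨q, hq, hq1, hq2⟩ := hmid (peak e t i + 3) (by omega)
    refine ⟨by norm_num, peak e t i + 3, by omega, q, hq, ?_, ?_⟩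
    · rw [hq1]; push_cast; ring
    · rw [hq2, (profile_side hit hN).2]
      have := hle _ hp
      norm_num
      linarith

/-- Every valley needs a guard of its own, and every wide valley needs two. -/
theorem le_card_of_cover (hπ0 : π 0 = 100) (hπ : ∀ j, 0 < j → j ≤ e → π j < 100)
    (hN : N = e + 4 * t + 2 * s) {G : Finset HalfGuard}
    (hG : ∀ g ∈ G, g.pos.2 ≤ 100)
    (hcov : ∀ p ∈ chainRegion (graphChain (profile π e t N)) N 100,
      ∃ g ∈ G, g.Sees (chainRegion (graphChain (profile π e t N)) N 100) p) :
    2 * t + s ≤ G.card := by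
  classical
  set R := chainRegion (graphChain (profile π e t N)) N 100
  let F : ℕ → Finset HalfGuard := fun i => {g ∈ G | ∃ w ∈ witnesses e t i, g.Sees R w}
  have hdisj : ∀ i ∈ Finset.range (t + s), ∀ i' ∈ Finset.range (t + s), i ≠ i' →
      Disjoint (F i) (F i') := by
    intro i hi i' hi' hne
    rw [Finset.mem_range] at hi hi'
    rw [Finset.disjoint_left]
    intro g hg hg'
    obtain ⟨hgG, w, hw, hs⟩ := Finset.mem_filter.1 hg
    obtain ⟨-, w', hw', hs'⟩ := Finset.mem_filter.1 hg'
    rcases lt_or_gt_of_ne hne with h | h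
    · exact not_sees_two_valleys hN h hi' hw hw' (hG g hgG) hs hs'
    · exact not_sees_two_valleys hN h hi hw' hw (hG g hgG) hs' hs
  have hF : ∀ i < t + s, ∀ w ∈ witnesses e t i, ∃ g ∈ F i, g.Sees R w := by
    intro i hi w hw
    obtain ⟨g, hg, hs⟩ := hcov w (witnesses_subset hπ0 hπ hN hi hw)
    exact ⟨g, Finset.mem_filter.2 ⟨hg, w, hw, hs⟩, hs⟩
  have hcard : ∀ i ∈ Finset.range (t + s), (if i < t then 2 else 1) ≤ (F i).card := by
    intro i hi
    rw [Finset.mem_range] at hi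
    split_ifs with hit
    · by_contra! hlt
      have hone := Finset.card_le_one.1 (Nat.le_of_lt_succ hlt)
      obtain ⟨g, hg, -⟩ := hF i hi _ (Or.inl rfl)
      refine not_sees_wide_valley (π := π) hN hit (hG g (Finset.mem_filter.1 hg).1) fun w hw => ?_
      obtain ⟨g', hg', hs'⟩ := hF i hi w hw
      rw [hone g hg g' hg']
      exact hs'
    · obtain ⟨g, hg, -⟩ := hF i hi _ (Or.inl rfl)
      exact Finset.card_pos.2 ⟨g, hg⟩
  have hsum : ∑ i ∈ Finset.range (t + s), (if i < t then 2 else 1) = 2 * t + s := by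
    rw [Finset.sum_range_add, Finset.sum_congr rfl fun i hi => if_pos (Finset.mem_range.1 hi),
      Finset.sum_congr rfl fun i _ => if_neg (Nat.not_lt.2 (Nat.le_add_right t i))]
    simp [mul_comm]
  calc 2 * t + s = _ := hsum.symm
    _ ≤ ∑ i ∈ Finset.range (t + s), (F i).card := Finset.sum_le_sum hcard
    _ = ((Finset.range (t + s)).biUnion F).card := (Finset.card_biUnion hdisj).symm
    _ ≤ G.card := Finset.card_le_card (Finset.biUnion_subset.2 fun i _ =>
        Finset.filter_subset _ _)

/-- The general lower bound. The first `c` vertices after the corner are convex, and all others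
but the bottoms of the valleys are reflex. -/
theorem exists_mountain_profile [NeZero (N + 1)] {c : ℕ} (hπ0 : π 0 = 100)
    (hπpos : ∀ j ≤ e, 0 < π j) (hπ : ∀ j, 0 < j → j ≤ e → π j < 100)
    (hN : N = e + 4 * t + 2 * s) (hm : 0 < t + s) (hce : c ≤ e)
    (hleft : ∀ j, 0 < j → j ≤ c →
      0 < profile π e t N (j + 1) - 2 * profile π e t N j + profile π e t N (j - 1))
    (hright : ∀ j, c < j → j ≤ e →
      profile π e t N (j + 1) - 2 * profile π e t N j + profile π e t N (j - 1) < 0) :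
    ∃ P : Polygon (ℝ × ℝ) (N + 1), P.IsMonotoneMountain ∧
      P.reflexCount = N - 1 - c - (t + s) ∧ P.HalfGuardsNecessary (2 * t + s) := by
  have h0 : profile π e t N 0 = 100 := by simp [profile, hπ0]
  have hNN : profile π e t N N = 100 := by
    unfold profile
    rw [if_neg (by omega), if_pos le_rfl]
  have hc : IsMountainChain (graphChain (profile π e t N)) N := by
    refine ⟨by omega, hNN.trans h0.symm, fun j _ => by simp [graphChain], ?_, ?_⟩
    · intro j hj hjN
      change profile π e t N j < profile π e t N 0
      rw [h0]
      exact profile_lt hπ hj hjN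
    · intro j hj hjN
      rw [turn_graphChain _ hj]
      rcases le_or_gt j c with h | h
      · exact (hleft j hj h).ne'
      rcases le_or_gt j e with h' | h'
      · exact (hright j h h').ne
      by_cases hb : ∃ i < t + s, j = bottom e t i
      · obtain ⟨i, hi, hij⟩ := hb
        exact (turn_bottom_pos hπpos hN hi hij).ne'
      · push Not at hb
        exact (turn_neg_of_ne_bottom hπ0 hπ hN h' hjN hb).ne
  let P : Polygon (ℝ × ℝ) (N + 1) := ⟨fun i => graphChain (profile π e t N) i⟩
  have hv : ∀ i : Fin (N + 1), P i = graphChain (profile π e t N) i := fun _ => rfl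
  refine ⟨P, hc.isMonotoneMountain ?_ hv, ?_, ?_⟩
  · simp only [graphChain]
    exact_mod_cast (by omega : 0 < N)
  · rw [hc.reflexCount_eq hv, reflexIn_profile hπ0 hπpos hπ hN hleft hright,
      card_reflexIn_profile hN hce hm]
  · rintro G ⟨hG, hcov⟩
    have hR : P.region = chainRegion (graphChain (profile π e t N)) N 100 := by
      rw [region_eq_chainRegion hv, ← h0]; rfl
    rw [hR] at hG hcov
    exact le_card_of_cover hπ0 hπ hN (fun g hg => (hG g hg).1) hcov

/-- Worst case mountains with `t` wide and `s` narrow valleys and `e` additional reflex vertices,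
placed on a concave arc that descends slightly from the left corner. -/
theorem exists_mountain_reflex (e t s : ℕ) [NeZero (e + 4 * t + 2 * s + 1)] (hm : 0 < t + s) :
    ∃ P : Polygon (ℝ × ℝ) (e + 4 * t + 2 * s + 1), P.IsMonotoneMountain ∧
      P.reflexCount = e + 3 * t + s - 1 ∧ P.HalfGuardsNecessary (2 * t + s) := by
  have hratio : ∀ j : ℕ, j ≤ e → (j : ℝ) ^ 2 / e ^ 2 ≤ 1 := by
    intro j hj
    refine div_le_one_of_le₀ ?_ (by positivity)
    have : (j : ℝ) ≤ e := by exact_mod_cast hj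
    gcongr
  obtain ⟨P, h1, h2, h3⟩ := exists_mountain_profile (π := fun j => 100 - (j : ℝ) ^ 2 / e ^ 2)
    (e := e) (t := t) (s := s) (N := e + 4 * t + 2 * s) (c := 0) (by simp)
    (fun j hj => by have := hratio j hj; linarith)
    (fun j hj hje => by
      have he : (0 : ℝ) < e := by exact_mod_cast (by omega : 0 < e)
      have hj' : (0 : ℝ) < j := by exact_mod_cast hj
      have : 0 < (j : ℝ) ^ 2 / e ^ 2 := by positivity
      linarith)
    rfl hm e.zero_le (fun j h h' => by omega)
    (fun j hj hje => by
      have he : (0 : ℝ) < e := by exact_mod_cast (by omega : 0 < e)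
      have hj1 : ((j - 1 : ℕ) : ℝ) = j - 1 := by rw [Nat.cast_sub (by omega)]; simp
      have hpre : ∀ i ≤ e, profile (fun j => 100 - (j : ℝ) ^ 2 / e ^ 2) e t
          (e + 4 * t + 2 * s) i = 100 - (i : ℝ) ^ 2 / e ^ 2 := fun i hi => if_pos hi
      rw [hpre j hje, hpre (j - 1) (by omega), hj1]
      rcases hje.eq_or_lt with rfl | hje
      · have h1 : profile (fun i => 100 - (i : ℝ) ^ 2 / j ^ 2) j t (j + 4 * t + 2 * s) (j + 1) ≤
            75 := by
          unfold profile
          rw [if_neg (by omega), if_neg (by omega)]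
          split_ifs <;> first | norm_num; done | omega
        have h2 : (j : ℝ) ^ 2 / j ^ 2 = 1 := div_self (by positivity)
        have h3 : (0 : ℝ) ≤ (j - 1 : ℝ) ^ 2 / j ^ 2 := by positivity
        rw [h2]
        linarith
      · rw [hpre (j + 1) hje]
        have : (100 - ((j + 1 : ℕ) : ℝ) ^ 2 / e ^ 2) - 2 * (100 - (j : ℝ) ^ 2 / e ^ 2) +
            (100 - (j - 1 : ℝ) ^ 2 / e ^ 2) = -(2 / e ^ 2) := by
          push_cast; field_simp; ring
        rw [this, neg_lt_zero]
        positivity)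
  exact ⟨P, h1, by omega, h3⟩

/-- Worst case mountains with `s` narrow valleys and `e` additional convex vertices, placed on a
convex arc that descends from the left corner to the bottom of the first valley. -/
theorem exists_mountain_convex (e s : ℕ) [NeZero (e + 2 * s + 1)] (hm : 0 < s) :
    ∃ P : Polygon (ℝ × ℝ) (e + 2 * s + 1), P.IsMonotoneMountain ∧
      P.reflexCount = s - 1 ∧ P.HalfGuardsNecessary s := by
  have he : (0 : ℝ) < e + 1 := by positivity
  set f : ℕ → ℝ := fun j => 100 * ((e + 1 - j : ℝ) / (e + 1)) ^ 2 with hf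
  obtain ⟨P, h1, h2, h3⟩ := exists_mountain_profile (π := f)
    (e := e) (t := 0) (s := s) (N := e + 2 * s) (c := e)
    (by simp only [hf, Nat.cast_zero, sub_zero]; rw [div_self he.ne']; norm_num)
    (fun j hj => by
      have : (j : ℝ) ≤ e := by exact_mod_cast hj
      have : (0 : ℝ) < e + 1 - j := by linarith
      simp only [hf]
      positivity)
    (fun j hj hje => by
      have h1 : (j : ℝ) ≤ e := by exact_mod_cast hje
      have h2 : (0 : ℝ) < j := by exact_mod_cast hj
      have h3 : (e + 1 - j : ℝ) / (e + 1) < 1 := by rw [div_lt_one he]; linarith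
      have h4 : 0 ≤ (e + 1 - j : ℝ) / (e + 1) := div_nonneg (by linarith) he.le
      simp only [hf]
      nlinarith)
    (by ring) (by omega) le_rfl
    (fun j hj hje => by
      have hj1 : ((j - 1 : ℕ) : ℝ) = j - 1 := by rw [Nat.cast_sub (by omega)]; simp
      -- the bottom of the first valley lies on the same parabola
      have hpre : ∀ i ≤ e + 1, profile f e 0 (e + 2 * s) i = f i := by
        intro i hi
        rcases Nat.le_succ_iff.1 hi with hi | rfl
        · exact if_pos hi
        · unfold profile
          rw [if_neg (by omega), if_neg (by omega), if_pos (by omega)]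
          simp [hf]
      rw [hpre j (by omega), hpre (j - 1) (by omega), hpre (j + 1) (by omega)]
      have : f (j + 1) - 2 * f j + f (j - 1) = 200 / (e + 1) ^ 2 := by
        simp only [hf, hj1]
        push_cast
        field_simp
        ring
      rw [this]
      positivity)
    (fun j h h' => by omega)
  exact ⟨P, h1, by omega, by simpa using h3⟩

end Family

/-! ### Choice of the parameters -/

theorem halfGuardsSuffice {n k : ℕ} [NeZero n] {P : Polygon (ℝ × ℝ) n}
    (hP : P.IsMonotoneMountain)
    (hk : P.reflexCount + 1 ≤ k ∨ n / 2 ≤ k ∨ 2 * (n - P.reflexCount - 2) ≤ k) :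
    P.HalfGuardsSuffice k := by
  obtain ⟨N, rfl⟩ := Nat.exists_eq_succ_of_ne_zero (NeZero.ne n)
  obtain ⟨G, hG, h1, h2, h3⟩ := exists_cover hP
  exact ⟨G, hG, by omega⟩

theorem exists_mountain_of_few_reflex {n r : ℕ} [NeZero n] (h : 2 * r + 3 ≤ n) :
    ∃ P : Polygon (ℝ × ℝ) n, P.IsMonotoneMountain ∧ P.reflexCount = r ∧
      P.HalfGuardsNecessary (r + 1) := by
  obtain ⟨e, rfl⟩ : ∃ e, n = e + 2 * (r + 1) + 1 := ⟨n - (2 * r + 3), by omega⟩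
  exact exists_mountain_convex e (r + 1) r.succ_pos

/-- Worst case mountains in the middle range. For an even number of vertices, one additional reflex
vertex is spent without forcing another guard. -/
theorem exists_mountain_of_medium_reflex {n r : ℕ} [NeZero n] (h1 : n ≤ 2 * r)
    (h2 : 4 * r + 7 ≤ 3 * n) :
    ∃ P : Polygon (ℝ × ℝ) n, P.IsMonotoneMountain ∧ P.reflexCount = r ∧
      P.HalfGuardsNecessary ((n - 1) / 2) := by
  obtain ⟨e, t, s, rfl, hm, hr, hk⟩ : ∃ e t s, n = e + 4 * t + 2 * s + 1 ∧ 0 < t + s ∧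
      r = e + 3 * t + s - 1 ∧ (n - 1) / 2 = 2 * t + s := by
    rcases Nat.even_or_odd' n with ⟨m, rfl | rfl⟩
    · exact ⟨1, r + 1 - m, m - 1 - 2 * (r + 1 - m), by omega, by omega, by omega, by omega⟩
    · exact ⟨0, r + 1 - m, m - 2 * (r + 1 - m), by omega, by omega, by omega, by omega⟩
  rw [hk, hr]
  exact exists_mountain_reflex e t s hm

theorem exists_mountain_of_many_reflex {n r : ℕ} [NeZero n] (h1 : 3 * n < 4 * r)
    (h2 : r + 3 ≤ n) :
    ∃ P : Polygon (ℝ × ℝ) n, P.IsMonotoneMountain ∧ P.reflexCount = r ∧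
      P.HalfGuardsNecessary (2 * (n - r - 2)) := by
  obtain ⟨e, t, rfl, hm, rfl⟩ : ∃ e t, n = e + 4 * t + 2 * 0 + 1 ∧ 0 < t + 0 ∧
      r = e + 3 * t + 0 - 1 :=
    ⟨n - 1 - 4 * (n - r - 2), n - r - 2, by omega, by omega, by omega⟩
  have hk : 2 * (e + 4 * t + 2 * 0 + 1 - (e + 3 * t + 0 - 1) - 2) = 2 * t + 0 := by omega
  rw [hk]
  exact exists_mountain_reflex e t 0 hm

end MonotoneMountain

theorem mainTheorem4 (n r : ℕ) [NeZero n] :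
    -- few reflex vertices
    ((r : ℝ) < (n : ℝ) / 2 →
      (∀ P : Polygon (ℝ × ℝ) n, P.IsMonotoneMountain → P.reflexCount = r →
        P.HalfGuardsSuffice (r + 1)) ∧
      (2 * r + 3 ≤ n →
        ∃ P : Polygon (ℝ × ℝ) n, P.IsMonotoneMountain ∧ P.reflexCount = r ∧
          P.HalfGuardsNecessary (r + 1))) ∧
    -- a medium number of reflex vertices
    ((n : ℝ) / 2 ≤ r → (r : ℝ) ≤ 3 * n / 4 →
      (∀ P : Polygon (ℝ × ℝ) n, P.IsMonotoneMountain → P.reflexCount = r →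
        P.HalfGuardsSuffice (n / 2)) ∧
      ((r : ℝ) ≤ (3 * n - 7) / 4 → Odd n →
        ∃ P : Polygon (ℝ × ℝ) n, P.IsMonotoneMountain ∧ P.reflexCount = r ∧
          P.HalfGuardsNecessary (n / 2)) ∧
      ((r : ℝ) ≤ (3 * n - 7) / 4 → Even n →
        ∃ P : Polygon (ℝ × ℝ) n, P.IsMonotoneMountain ∧ P.reflexCount = r ∧
          P.HalfGuardsNecessary (n / 2 - 1))) ∧
    -- many reflex vertices
    ((r : ℝ) > 3 * n / 4 → r + 3 ≤ n →
      2 * ((n : ℝ) - r - 2) ≤ n / 2 ∧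
      (∀ P : Polygon (ℝ × ℝ) n, P.IsMonotoneMountain → P.reflexCount = r →
        P.HalfGuardsSuffice (2 * (n - r - 2))) ∧
      ∃ P : Polygon (ℝ × ℝ) n, P.IsMonotoneMountain ∧ P.reflexCount = r ∧
        P.HalfGuardsNecessary (2 * (n - r - 2))) := by
  refine ⟨fun _ => ⟨fun P hP hr => ?_, MonotoneMountain.exists_mountain_of_few_reflex⟩,
    fun h1 _ => ⟨fun P hP _ => ?_, fun h2 hodd => ?_, fun h2 heven => ?_⟩,
    fun h1 h2 => ⟨?_, fun P hP hr => ?_, ?_⟩⟩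
  · exact MonotoneMountain.halfGuardsSuffice hP (Or.inl (by rw [hr]))
  · exact MonotoneMountain.halfGuardsSuffice hP (Or.inr (Or.inl le_rfl))
  · have h1' : n ≤ 2 * r := by
      have : (n : ℝ) ≤ 2 * r := by linarith
      exact_mod_cast this
    have h2' : 4 * r + 7 ≤ 3 * n := by
      have : (4 * r + 7 : ℝ) ≤ 3 * n := by linarith
      exact_mod_cast this
    have hk : n / 2 = (n - 1) / 2 := by
      obtain ⟨m, rfl⟩ := hodd
      omega
    rw [hk]
    exact MonotoneMountain.exists_mountain_of_medium_reflex h1' h2'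
  · have h1' : n ≤ 2 * r := by
      have : (n : ℝ) ≤ 2 * r := by linarith
      exact_mod_cast this
    have h2' : 4 * r + 7 ≤ 3 * n := by
      have : (4 * r + 7 : ℝ) ≤ 3 * n := by linarith
      exact_mod_cast this
    have hk : n / 2 - 1 = (n - 1) / 2 := by
      obtain ⟨m, rfl⟩ := heven
      omega
    rw [hk]
    exact MonotoneMountain.exists_mountain_of_medium_reflex h1' h2'
  · linarith [(Nat.cast_nonneg n : (0 : ℝ) ≤ n)]
  · exact MonotoneMountain.halfGuardsSuffice hP (Or.inr (Or.inr (by rw [hr])))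
  · refine MonotoneMountain.exists_mountain_of_many_reflex ?_ h2
    have : (3 * n : ℝ) < 4 * r := by linarith
    exact_mod_cast this
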